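/- **Theorem.** Deciding connectivity of undirected graphs requires $\Omega(n^{3/2})$ quantum queries in the adjacency matrix model, for algorithms with bounded error. Precisely: for every $\varepsilon\in[0,1/2)$ there are a constant $c>0$ and an $N\in\mathbb N$, depending only on $\varepsilon$, such that for every $n\ge N$, every quantum query algorithm that decides for every undirected simple graph $G$ on $n$ vertices whether $G$ is connected, with error probability at most $\varepsilon$ on each $G$, makes at least $c\,n^{3/2}$ queries. Here the input is the adjacency matrix $M\in\{0,1\}^{n\times n}$ of $G$. A quantum query algorithm with $T$ queries works on a finite-dimensional space with orthonormal basis $|i,j,b,w\rangle$, where $i,j$ are vertices, $b\in\{0,1\}$, and $w$ ranges over a finite work register of arbitrary size. It starts in a fixed basis state $|s\rangle$ and computes $U_T O_M U_{T-1} O_M\cdots U_1 O_M U_0|s\rangle$, where $U_0,\dots,U_T$ are unitary maps that do not depend on $M$ and a query is the unitary map $O_M|i,j,b,w\rangle=|i,j,b\oplus M_{ij},w\rangle$. The final state is measured in this basis, and the algorithm accepts (answers "connected") if and only if the outcome lies in a fixed set of basis states. -/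

import Mathlib

/-- Computational basis of a quantum query machine whose input is a Boolean string indexed by `ι`:
a basis state `(i, b, w)` consists of a query register `i`, an answer bit `b` and a work register
`w` with `d` basis states. -/
abbrev QueryBasis (ι : Type) (d : ℕ) : Type := ι × Bool × Fin d

/-- The (finite-dimensional) state space of the machine. -/
abbrev QueryState (ι : Type) (d : ℕ) : Type := EuclideanSpace ℂ (QueryBasis ι d)

/-- The permutation `(i, b, w) ↦ (i, b ⊕ x i, w)` of the computational basis. -/
def oraclePerm {ι : Type} (d : ℕ) (x : ι → Bool) : Equiv.Perm (QueryBasis ι d) where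
  toFun s := (s.1, xor s.2.1 (x s.1), s.2.2)
  invFun s := (s.1, xor s.2.1 (x s.1), s.2.2)
  left_inv s := by simp
  right_inv s := by simp

/-- The query operator of the input `x`: the unitary map with
`|i, b, w⟩ ↦ |i, b ⊕ x i, w⟩`. -/
noncomputable def oracle {ι : Type} [Fintype ι] (d : ℕ) (x : ι → Bool) :
    QueryState ι d ≃ₗᵢ[ℂ] QueryState ι d :=
  LinearIsometryEquiv.piLpCongrLeft 2 ℂ ℂ (oraclePerm d x)

theorem oracle_apply {ι : Type} [Fintype ι] (d : ℕ) (x : ι → Bool) (v : QueryState ι d)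
    (s : QueryBasis ι d) : oracle d x v s = v (s.1, xor s.2.1 (x s.1), s.2.2) := rfl

theorem oracle_single {ι : Type} [Fintype ι] [DecidableEq ι] (d : ℕ) (x : ι → Bool)
    (s : QueryBasis ι d) :
    oracle d x (EuclideanSpace.single s 1) =
      EuclideanSpace.single (s.1, xor s.2.1 (x s.1), s.2.2) 1 :=
  EuclideanSpace.piLpCongrLeft_single (oraclePerm d x) s 1

/-- A quantum query algorithm for Boolean inputs indexed by `ι`. It starts in the basis state
`start`, applies `unitary 0`, then alternates the query operator with the input-independent unitary
maps `unitary 1, …, unitary queries`; finally the state is measured in the computational basis, and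
the algorithm accepts if the outcome lies in `accept`. (The maps `unitary t` with `t > queries` are
never used.) -/
structure QuantumQueryAlgorithm (ι : Type) [Fintype ι] where
  /-- dimension of the work register -/
  workDim : ℕ
  /-- number of queries made -/
  queries : ℕ
  /-- initial basis state -/
  start : QueryBasis ι workDim
  /-- the unitary maps between the queries -/
  unitary : ℕ → (QueryState ι workDim ≃ₗᵢ[ℂ] QueryState ι workDim)
  /-- accepting measurement outcomes -/
  accept : Finset (QueryBasis ι workDim)

namespace QuantumQueryAlgorithm

/-- The state on input `x` after `t` queries and the unitary map that follows the last of them. -/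
noncomputable def state {ι : Type} [Fintype ι] [DecidableEq ι]
    (A : QuantumQueryAlgorithm ι) (x : ι → Bool) : ℕ → QueryState ι A.workDim
  | 0 => A.unitary 0 (EuclideanSpace.single A.start 1)
  | t + 1 => A.unitary (t + 1) (oracle A.workDim x (state A x t))

/-- The probability that the algorithm accepts the input `x`. -/
noncomputable def acceptProb {ι : Type} [Fintype ι] [DecidableEq ι]
    (A : QuantumQueryAlgorithm ι) (x : ι → Bool) : ℝ :=
  ∑ s ∈ A.accept, ‖A.state x A.queries s‖ ^ 2

end QuantumQueryAlgorithm

open Classical in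
/-- The adjacency matrix of an undirected graph on `n` vertices, as a Boolean input whose entries
are indexed by the ordered pairs of vertices. -/
noncomputable def adjacencyInput {n : ℕ} (G : SimpleGraph (Fin n)) : Fin n × Fin n → Bool :=
  fun p => decide (G.Adj p.1 p.2)

/-- The algorithm, which queries entries of the adjacency matrix, decides on every undirected graph
on `n` vertices whether it is connected, with error probability at most `ε`. -/
def DecidesConnectivity (n : ℕ) (ε : ℝ) (A : QuantumQueryAlgorithm (Fin n × Fin n)) : Prop :=
  ∀ G : SimpleGraph (Fin n),
    (G.Connected → 1 - ε ≤ A.acceptProb (adjacencyInput G)) ∧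
    (¬ G.Connected → A.acceptProb (adjacencyInput G) ≤ ε)

/-! This is an adversary argument. Pair the `n`-cycle with the union of two cycles of lengths `r = m
+ t` and `n - r`, for `t < m` and `m = n / 4`, under every relabelling of the vertices. The two
graphs differ only among four vertex pairs: `{r-1, r}` and `{n-1, 0}` are traded for `{r-1, 0}` and
`{n-1, r}`. Final states must be far apart on each pair of inputs, while one query adds little to
the summed squared distances (`adversary_bound`).

The gain comes from non-edges. By `card_mul_sum_comap_le`, query weight on a switched pair is spread
over its images under automorphisms. Where the pair is an edge, `m` rotations bound its total weight
by `n!`. Where it is a non-edge it has about `m ^ 2` possible places, and the bound is `n! / m`. By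
Cauchy–Schwarz one query contributes `O(n! / √m)` against `n! * m` pairs, so `Ω(m * √m)` queries are
needed (`connectivity_weight_bound`). -/

/-- The component of a state of the machine in which the query register holds `i`. -/
noncomputable def querySlice {ι : Type} {d : ℕ} (v : QueryState ι d) (i : ι) :
    EuclideanSpace ℂ (Bool × Fin d) :=
  WithLp.toLp 2 fun s => v (i, s)

theorem querySlice_sub {ι : Type} {d : ℕ} (v w : QueryState ι d) (i : ι) :
    querySlice (v - w) i = querySlice v i - querySlice w i := rfl

theorem sum_norm_querySlice_sq {ι : Type} [Fintype ι] {d : ℕ} (v : QueryState ι d) :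
    ∑ i, ‖querySlice v i‖ ^ 2 = ‖v‖ ^ 2 := by
  simp only [EuclideanSpace.norm_sq_eq, querySlice]
  exact (Fintype.sum_prod_type (fun s : QueryBasis ι d => ‖v s‖ ^ 2)).symm

theorem norm_querySlice_oracle {ι : Type} [Fintype ι] {d : ℕ} (x : ι → Bool)
    (v : QueryState ι d) (i : ι) : ‖querySlice (oracle d x v) i‖ = ‖querySlice v i‖ := by
  rw [← sq_eq_sq₀ (norm_nonneg _) (norm_nonneg _)]
  simp only [EuclideanSpace.norm_sq_eq, querySlice, oracle_apply]
  rw [Fintype.sum_prod_type, Fintype.sum_prod_type, Fintype.sum_bool, Fintype.sum_bool]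
  cases x i <;> simp [add_comm]

theorem querySlice_oracle_congr {ι : Type} [Fintype ι] {d : ℕ} {x y : ι → Bool} {i : ι}
    (h : x i = y i) (v : QueryState ι d) :
    querySlice (oracle d x v) i = querySlice (oracle d y v) i := by
  ext s
  simp [querySlice, oracle_apply, h]

/-- One query increases the squared distance of two states only through the components in which
a position is queried where the two inputs differ. -/
theorem norm_oracle_sub_oracle_sq_le {ι : Type} [Fintype ι] {d : ℕ} (x y : ι → Bool)
    (v w : QueryState ι d) :
    ‖oracle d x v - oracle d y w‖ ^ 2 ≤ ‖v - w‖ ^ 2 +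
      4 * ∑ i with x i ≠ y i, ‖querySlice v i‖ * ‖querySlice w i‖ := by
  rw [← sum_norm_querySlice_sq, ← sum_norm_querySlice_sq (v - w), Finset.sum_filter,
    Finset.mul_sum, ← Finset.sum_add_distrib]
  refine Finset.sum_le_sum fun i _ => ?_
  by_cases h : x i = y i
  · rw [querySlice_sub, ← querySlice_oracle_congr h, ← querySlice_sub, ← map_sub,
      norm_querySlice_oracle]
    simp [h]
  · rw [if_pos h, querySlice_sub, querySlice_sub]
    -- `(a + b) ^ 2 = (a - b) ^ 2 + 4 * a * b` for the norms `a`, `b` of the two slices.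
    have h₁ := norm_sub_le (querySlice (oracle d x v) i) (querySlice (oracle d y w) i)
    rw [norm_querySlice_oracle, norm_querySlice_oracle] at h₁
    have h₂ := abs_norm_sub_norm_le (querySlice v i) (querySlice w i)
    have h₃ := pow_le_pow_left₀ (norm_nonneg _) h₁ 2
    have h₄ := pow_le_pow_left₀ (abs_nonneg _) h₂ 2
    rw [sq_abs] at h₄
    nlinarith

namespace QuantumQueryAlgorithm

variable {ι : Type} [Fintype ι] [DecidableEq ι]

theorem norm_state (A : QuantumQueryAlgorithm ι) (x : ι → Bool) (t : ℕ) :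
    ‖A.state x t‖ = 1 := by
  induction t with
  | zero => simp [state]
  | succ t ih => simpa [state] using ih

/-- States that are accepted with probabilities on either side of `1 / 2` are far apart. -/
theorem sqrt_sub_sqrt_le_norm_state_sub (A : QuantumQueryAlgorithm ι) {x y : ι → Bool} {p q : ℝ}
    (hx : p ≤ A.acceptProb x) (hy : A.acceptProb y ≤ q) :
    √p - √q ≤ ‖A.state x A.queries - A.state y A.queries‖ := by
  let P : QueryState ι A.workDim → EuclideanSpace ℂ A.accept := fun v => WithLp.toLp 2 fun s => v s
  have hP : ∀ v, ‖P v‖ ^ 2 = ∑ s ∈ A.accept, ‖v s‖ ^ 2 := fun v => by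
    rw [EuclideanSpace.norm_sq_eq]
    exact Finset.sum_coe_sort A.accept fun s => ‖v s‖ ^ 2
  have hle : ∀ v, ‖P v‖ ≤ ‖v‖ := fun v => by
    rw [← sq_le_sq₀ (norm_nonneg _) (norm_nonneg _), hP, EuclideanSpace.norm_sq_eq]
    exact Finset.sum_le_univ_sum_of_nonneg fun _ => sq_nonneg _
  have h₁ : √p ≤ ‖P (A.state x A.queries)‖ :=
    Real.sqrt_le_iff.2 ⟨norm_nonneg _, (hP _).symm ▸ hx⟩
  have h₂ : ‖P (A.state y A.queries)‖ ≤ √q := Real.le_sqrt_of_sq_le ((hP _).symm ▸ hy)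
  have h₃ := norm_sub_norm_le (P (A.state x A.queries)) (P (A.state y A.queries))
  have h₄ : ‖P (A.state x A.queries) - P (A.state y A.queries)‖ ≤ _ :=
    hle (A.state x A.queries - A.state y A.queries)
  linarith

/-! ### The adversary method -/

/-- The adversary bound for a finite family of pairs `(x k, y k)` of inputs to be distinguished.
The positions in which `x k` and `y k` differ are among the `d j k`. -/
theorem adversary_bound (A : QuantumQueryAlgorithm ι) {K J : Type*} [Fintype K] [Fintype J]
    (x y : K → ι → Bool) (d : J → K → ι) (hd : ∀ k i, x k i ≠ y k i → ∃ j, d j k = i)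
    {p q C : ℝ} (hqp : q ≤ p) (hx : ∀ k, p ≤ A.acceptProb (x k))
    (hy : ∀ k, A.acceptProb (y k) ≤ q)
    (hC : ∀ w : (ι → Bool) → ι → ℝ, (∀ z i, 0 ≤ w z i) → (∀ z, ∑ i, w z i ≤ 1) →
      ∀ j, (∑ k, w (x k) (d j k)) * (∑ k, w (y k) (d j k)) ≤ C ^ 2) (hC₀ : 0 ≤ C) :
    Fintype.card K * (√p - √q) ^ 2 ≤ A.queries * (4 * (Fintype.card J * C)) := by
  have step : ∀ t, ∑ k, ‖A.state (x k) t - A.state (y k) t‖ ^ 2 ≤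
      t * (4 * (Fintype.card J * C)) := by
    intro t
    induction t with
    | zero => simp [state]
    | succ t ih =>
      have h₁ : ∀ k, ‖A.state (x k) (t + 1) - A.state (y k) (t + 1)‖ ^ 2 ≤
          ‖A.state (x k) t - A.state (y k) t‖ ^ 2 + 4 * ∑ j,
            ‖querySlice (A.state (x k) t) (d j k)‖ * ‖querySlice (A.state (y k) t) (d j k)‖ := by
        intro k
        simp only [state, ← map_sub, LinearIsometryEquiv.norm_map]
        refine (norm_oracle_sub_oracle_sq_le _ _ _ _).trans ?_
        gcongr
        classical
        calc _ ≤ ∑ i ∈ Finset.univ.image fun j => d j k,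
              ‖querySlice (A.state (x k) t) i‖ * ‖querySlice (A.state (y k) t) i‖ := by
              refine Finset.sum_le_sum_of_subset_of_nonneg (fun i hi => ?_)
                fun _ _ _ => by positivity
              simpa using hd k i (by simpa using hi)
          _ ≤ _ := Finset.sum_image_le_of_nonneg fun _ _ => by positivity
      have h₂ : ∀ j, ∑ k, ‖querySlice (A.state (x k) t) (d j k)‖ *
          ‖querySlice (A.state (y k) t) (d j k)‖ ≤ C := by
        intro j
        -- Cauchy–Schwarz over `k`; squared slice norms are query probabilities, hence admissible
        -- weights in `hC`.
        refine (sq_le_sq₀ (Finset.sum_nonneg fun _ _ => by positivity) hC₀).1 ?_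
        refine (Finset.sum_mul_sq_le_sq_mul_sq _ _ _).trans ?_
        refine hC (fun z i => ‖querySlice (A.state z t) i‖ ^ 2) (fun _ _ => by positivity) ?_ j
        intro z
        rw [sum_norm_querySlice_sq, norm_state, one_pow]
      calc _ ≤ _ := Finset.sum_le_sum fun k _ => h₁ k
        _ = ∑ k, ‖A.state (x k) t - A.state (y k) t‖ ^ 2 + 4 * ∑ j, ∑ k,
            ‖querySlice (A.state (x k) t) (d j k)‖ *
              ‖querySlice (A.state (y k) t) (d j k)‖ := by
            rw [Finset.sum_add_distrib, ← Finset.mul_sum, Finset.sum_comm]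
        _ ≤ t * (4 * (Fintype.card J * C)) + 4 * ∑ _j : J, C := by
            gcongr with j
            exact h₂ j
        _ = _ := by
            rw [Finset.sum_const, Finset.card_univ, nsmul_eq_mul]
            push_cast
            ring
  refine le_trans ?_ (step A.queries)
  rw [← nsmul_eq_mul, ← Finset.card_univ]
  refine Finset.card_nsmul_le_sum _ _ _ fun k _ => ?_
  exact pow_le_pow_left₀ (sub_nonneg.2 (Real.sqrt_le_sqrt hqp))
    (A.sqrt_sub_sqrt_le_norm_state_sub (hx k) (hy k)) 2

end QuantumQueryAlgorithm

/-! ### Averaging over automorphisms -/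

/-- The total weight that the isomorphic copies of a graph put on the images of given pairs of
vertices is small if automorphisms move these pairs to many places. -/
theorem card_mul_sum_comap_le {V : Type*} [Fintype V] [DecidableEq V] (G : SimpleGraph V)
    (w : SimpleGraph V → V × V → ℝ) (hw₀ : ∀ H e, 0 ≤ w H e) (hw : ∀ H, ∑ e, w H e ≤ 1)
    {S L : Type*} [Fintype S] [Fintype L] (p : S → V × V) (g : L → Equiv.Perm V)
    (hg : ∀ l, G.comap (g l) = G)
    (hinj : Function.Injective fun s : S × L => Prod.map (g s.2) (g s.2) (p s.1)) :
    Fintype.card L * ∑ σ : Equiv.Perm V, ∑ s, w (G.comap σ) (Prod.map σ.symm σ.symm (p s)) ≤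
      (Fintype.card V).factorial := by
  -- Substituting `(g l)⁻¹ * σ` for `σ` fixes the copy of `G` but moves the pair by `g l`.
  have h₁ : ∀ l, ∑ σ : Equiv.Perm V, ∑ s, w (G.comap σ) (Prod.map σ.symm σ.symm (p s)) =
      ∑ σ : Equiv.Perm V, ∑ s,
        w (G.comap σ) (Prod.map σ.symm σ.symm (Prod.map (g l) (g l) (p s))) := by
    intro l
    symm
    refine Fintype.sum_equiv (Equiv.mulLeft (g l)⁻¹) _ _ fun σ => ?_
    have h : G.comap ⇑((g l)⁻¹ * σ) = G.comap σ := by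
      conv_lhs => rw [← hg l]
      ext u v
      simp
    rw [Equiv.coe_mulLeft, h]
    rfl
  -- Within one copy of `G`, the moved pairs are distinct positions sharing total weight at most 1.
  have h₂ : ∀ σ : Equiv.Perm V, ∑ l, ∑ s,
      w (G.comap σ) (Prod.map σ.symm σ.symm (Prod.map (g l) (g l) (p s))) ≤ 1 := by
    intro σ
    have hi : Function.Injective fun s : S × L =>
        Prod.map σ.symm σ.symm (Prod.map (g s.2) (g s.2) (p s.1)) :=
      (σ.symm.injective.prodMap σ.symm.injective).comp hinj
    rw [Finset.sum_comm, ← Fintype.sum_prod_type']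
    calc _ = ∑ e ∈ Finset.univ.image fun s : S × L =>
          Prod.map σ.symm σ.symm (Prod.map (g s.2) (g s.2) (p s.1)), w (G.comap σ) e :=
          (Finset.sum_image fun _ _ _ _ h => hi h).symm
      _ ≤ ∑ e, w (G.comap σ) e := Finset.sum_le_univ_sum_of_nonneg fun _ => hw₀ _ _
      _ ≤ 1 := hw _
  calc _ = ∑ l : L, ∑ σ : Equiv.Perm V, ∑ s,
        w (G.comap σ) (Prod.map σ.symm σ.symm (Prod.map (g l) (g l) (p s))) := by
        rw [← Finset.sum_congr rfl fun l _ => h₁ l, Finset.sum_const, Finset.card_univ,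
          nsmul_eq_mul]
    _ = ∑ σ : Equiv.Perm V, ∑ l, ∑ s,
        w (G.comap σ) (Prod.map σ.symm σ.symm (Prod.map (g l) (g l) (p s))) := Finset.sum_comm
    _ ≤ ∑ _σ : Equiv.Perm V, (1 : ℝ) := Finset.sum_le_sum fun σ _ => h₂ σ
    _ = _ := by simp [Fintype.card_perm]

/-! ### One cycle and two cycles -/

/-- The vertex `j` follows the vertex `i` in the partition of `Fin n` into the two directed cycles
`0, …, r - 1` and `r, …, n - 1`. -/
def cycleSucc (n r : ℕ) (i j : Fin n) : Prop :=
  (i.val + 1 = j.val ∧ j.val ≠ r) ∨ (i.val + 1 = r ∧ j.val = 0) ∨ (i.val + 1 = n ∧ j.val = r)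

/-- The graph consisting of the two cycles `0, …, r - 1` and `r, …, n - 1`; for `r = n` it is a
single cycle. -/
def twoCycles (n r : ℕ) : SimpleGraph (Fin n) := SimpleGraph.fromRel (cycleSucc n r)

theorem connected_twoCycles_self {n : ℕ} (hn : 0 < n) : (twoCycles n n).Connected := by
  have h : ∀ k (hk : k < n), (twoCycles n n).Reachable ⟨0, hn⟩ ⟨k, hk⟩ := by
    intro k
    induction k with
    | zero => exact fun _ => SimpleGraph.Reachable.refl _
    | succ k ih =>
      intro hk
      refine (ih (by omega)).trans (SimpleGraph.Adj.reachable ?_)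
      simp [twoCycles, cycleSucc]
      omega
  exact (SimpleGraph.connected_iff_exists_forall_reachable _).2 ⟨⟨0, hn⟩, fun v => h v v.2⟩

theorem not_connected_twoCycles {n r : ℕ} (hr : 0 < r) (hrn : r < n) :
    ¬ (twoCycles n r).Connected := by
  intro h
  have key : ∀ u v : Fin n, (twoCycles n r).Reachable u v → (u.val < r ↔ v.val < r) := by
    rintro u v ⟨p⟩
    induction p with
    | nil => rfl
    | cons h _ ih =>
      rw [← ih]
      simp only [twoCycles, cycleSucc, SimpleGraph.fromRel_adj] at h
      omega
  have := key ⟨0, by omega⟩ ⟨r, hrn⟩ (h.preconnected _ _)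
  simp at this
  omega

theorem connected_comap_equiv {V : Type*} (G : SimpleGraph V) (σ : Equiv.Perm V) :
    (G.comap σ).Connected ↔ G.Connected :=
  (SimpleGraph.Iso.comap σ G).connected_iff

/-- Rotation of `0, …, r - 1` by `a` and of `r, …, n - 1` by `b`. -/
def blockRotate {n r a b : ℕ} (hr : r ≤ n) (ha : a ≤ r) (hb : b ≤ n - r) (i : Fin n) : Fin n :=
  ⟨if i.val < r then (if i.val + a < r then i.val + a else i.val + a - r)
    else (if i.val + b < n then i.val + b else i.val + b - (n - r)), by split_ifs <;> omega⟩

theorem blockRotate_injective {n r a b : ℕ} (hr : r ≤ n) (ha : a ≤ r) (hb : b ≤ n - r) :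
    Function.Injective (blockRotate hr ha hb) := by
  intro i j h
  simp only [blockRotate, Fin.mk.injEq] at h
  ext
  split_ifs at h <;> omega

/-- `blockRotate` as a permutation. -/
noncomputable def blockRotatePerm {n r a b : ℕ} (hr : r ≤ n) (ha : a ≤ r) (hb : b ≤ n - r) :
    Equiv.Perm (Fin n) :=
  Equiv.ofBijective _ (Finite.injective_iff_bijective.1 (blockRotate_injective hr ha hb))

theorem cycleSucc_blockRotate {n r a b : ℕ} (hr : r ≤ n) (ha : a ≤ r) (hb : b ≤ n - r)
    (i j : Fin n) : cycleSucc n r (blockRotate hr ha hb i) (blockRotate hr ha hb j) ↔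
      cycleSucc n r i j := by
  simp only [blockRotate, cycleSucc]
  split_ifs <;> omega

theorem comap_blockRotatePerm {n r a b : ℕ} (hr : r ≤ n) (ha : a ≤ r) (hb : b ≤ n - r) :
    (twoCycles n r).comap (blockRotatePerm hr ha hb) = twoCycles n r := by
  ext i j
  simp only [twoCycles, SimpleGraph.comap_adj, SimpleGraph.fromRel_adj, ne_eq,
    EmbeddingLike.apply_eq_iff_eq]
  simp only [blockRotatePerm, Equiv.ofBijective_apply, cycleSucc_blockRotate]

/-- Cutting the cycle at `r` only redirects the arcs that leave `r - 1` or `n - 1`, and these enter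
`r` or `0`. -/
theorem cycleSucc_self_iff {n r : ℕ} (hr : r < n) {u v : Fin n}
    (h : (u.val + 1 ≠ r ∧ u.val + 1 ≠ n) ∨ (v.val ≠ r ∧ v.val ≠ 0)) :
    cycleSucc n n u v ↔ cycleSucc n r u v := by
  simp only [cycleSucc]
  omega

/-- The pairs of vertices, in either order, that are adjacent in exactly one of `twoCycles n n` and
`twoCycles n r`; the flags select one of them. -/
def switchedPair {n r : ℕ} (hr : r < n) (j : Bool × Bool × Bool) : Fin n × Fin n :=
  let u : Fin n := ⟨if j.2.1 then r - 1 else n - 1, by split_ifs <;> omega⟩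
  let v : Fin n := ⟨if j.2.2 then r else 0, by split_ifs <;> omega⟩
  if j.1 then (u, v) else (v, u)

theorem exists_switchedPair_eq {n r : ℕ} (hr : r < n) (u v : Fin n)
    (h : ¬ ((twoCycles n n).Adj u v ↔ (twoCycles n r).Adj u v)) :
    ∃ j, switchedPair hr j = (u, v) := by
  have key : ∀ a b : Fin n, ¬ (cycleSucc n n a b ↔ cycleSucc n r a b) →
      a = ⟨if a.val + 1 = r then r - 1 else n - 1, by split_ifs <;> omega⟩ ∧
        b = ⟨if b.val = r then r else 0, by split_ifs <;> omega⟩ := by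
    intro a b hab
    have := mt (cycleSucc_self_iff hr) hab
    constructor <;> ext <;> dsimp only <;> split_ifs <;> omega
  by_cases h₁ : cycleSucc n n u v ↔ cycleSucc n r u v
  · have h₂ : ¬ (cycleSucc n n v u ↔ cycleSucc n r v u) := fun h₂ => h <| by
      simp only [twoCycles, SimpleGraph.fromRel_adj, h₁, h₂]
    refine ⟨(false, decide (v.val + 1 = r), decide (u.val = r)), ?_⟩
    simpa [switchedPair] using ⟨(key _ _ h₂).2.symm, (key _ _ h₂).1.symm⟩
  · refine ⟨(true, decide (u.val + 1 = r), decide (v.val = r)), ?_⟩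
    simpa [switchedPair] using ⟨(key _ _ h₁).1.symm, (key _ _ h₁).2.symm⟩

/-! ### Weight on the switched pairs -/

theorem sum_cycle_switchedPair_le {n m : ℕ} (hm : 4 * m ≤ n)
    (w : SimpleGraph (Fin n) → Fin n × Fin n → ℝ) (hw₀ : ∀ H e, 0 ≤ w H e)
    (hw : ∀ H, ∑ e, w H e ≤ 1) (t : Fin m) (ht : m + t < n) (j : Bool × Bool × Bool) :
    m * ∑ σ : Equiv.Perm (Fin n), w ((twoCycles n n).comap σ)
      (Prod.map σ.symm σ.symm (switchedPair ht j)) ≤ n.factorial := by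
  have := card_mul_sum_comap_le (twoCycles n n) w hw₀ hw (S := Unit) (L := Fin m)
    (fun _ => switchedPair ht j)
    (fun l => blockRotatePerm le_rfl (show l.val ≤ n by omega) (Nat.zero_le _))
    (fun l => comap_blockRotatePerm _ _ _) (by
      rintro ⟨_, l⟩ ⟨_, l'⟩ h
      obtain ⟨s, b, b'⟩ := j
      cases s <;> cases b <;> cases b' <;>
      · simp [switchedPair, blockRotatePerm, blockRotate] at h
        refine Prod.ext rfl (Fin.ext ?_)
        dsimp only
        split_ifs at h <;> omega)
  simpa using this

/-- Unequal flags select a chord whose length varies with `t`, while the cycle does not depend on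
`t`. So `t` and the rotation together give `m * m` places in one graph. -/
theorem sum_cycle_switchedPair_nonedge_le {n m : ℕ} (hm : 4 * m ≤ n)
    (w : SimpleGraph (Fin n) → Fin n × Fin n → ℝ) (hw₀ : ∀ H e, 0 ≤ w H e)
    (hw : ∀ H, ∑ e, w H e ≤ 1) (j : Bool × Bool × Bool) (hj : j.2.1 ≠ j.2.2) :
    m * ∑ σ : Equiv.Perm (Fin n), ∑ t : Fin m, w ((twoCycles n n).comap σ)
      (Prod.map σ.symm σ.symm (switchedPair (show m + t.val < n by omega) j)) ≤ n.factorial := by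
  have := card_mul_sum_comap_le (twoCycles n n) w hw₀ hw (S := Fin m) (L := Fin m)
    (fun t => switchedPair (show m + t.val < n by omega) j)
    (fun l => blockRotatePerm le_rfl (show l.val ≤ n by omega) (Nat.zero_le _))
    (fun l => comap_blockRotatePerm _ _ _) (by
      rintro ⟨t, l⟩ ⟨t', l'⟩ h
      obtain ⟨s, b, b'⟩ := j
      cases s <;> cases b <;> cases b' <;> first | exact absurd rfl hj | skip
      all_goals
        simp [switchedPair, blockRotatePerm, blockRotate] at h
        ext <;> dsimp only <;> split_ifs at h <;> omega)
  simpa using this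

theorem sum_twoCycles_switchedPair_le {n m : ℕ} (hm : 4 * m ≤ n)
    (w : SimpleGraph (Fin n) → Fin n × Fin n → ℝ) (hw₀ : ∀ H e, 0 ≤ w H e)
    (hw : ∀ H, ∑ e, w H e ≤ 1) (t : Fin m) (ht : m + t < n) (j : Bool × Bool × Bool) :
    m * ∑ σ : Equiv.Perm (Fin n), w ((twoCycles n (m + t)).comap σ)
      (Prod.map σ.symm σ.symm (switchedPair ht j)) ≤ n.factorial := by
  have := card_mul_sum_comap_le (twoCycles n (m + t)) w hw₀ hw (S := Unit) (L := Fin m)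
    (fun _ => switchedPair ht j)
    (fun l => blockRotatePerm ht.le (show l.val ≤ m + t.val by omega)
      (show l.val ≤ n - (m + t.val) by omega))
    (fun l => comap_blockRotatePerm _ _ _) (by
      rintro ⟨_, l⟩ ⟨_, l'⟩ h
      obtain ⟨s, b, b'⟩ := j
      cases s <;> cases b <;> cases b' <;>
      · simp [switchedPair, blockRotatePerm, blockRotate] at h
        refine Prod.ext rfl (Fin.ext ?_)
        dsimp only
        split_ifs at h <;> omega)
  simpa using this

/-- Equal flags select a pair with one end in each cycle. Here `t` changes the graph, so the second
factor `m` comes from rotating the cycles independently. -/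
theorem sum_twoCycles_switchedPair_nonedge_le {n m : ℕ} (hm : 4 * m ≤ n)
    (w : SimpleGraph (Fin n) → Fin n × Fin n → ℝ) (hw₀ : ∀ H e, 0 ≤ w H e)
    (hw : ∀ H, ∑ e, w H e ≤ 1) (t : Fin m) (ht : m + t < n) (j : Bool × Bool × Bool)
    (hj : j.2.1 = j.2.2) :
    m * m * ∑ σ : Equiv.Perm (Fin n), w ((twoCycles n (m + t)).comap σ)
      (Prod.map σ.symm σ.symm (switchedPair ht j)) ≤ n.factorial := by
  have := card_mul_sum_comap_le (twoCycles n (m + t)) w hw₀ hw (S := Unit) (L := Fin m × Fin m)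
    (fun _ => switchedPair ht j)
    (fun l => blockRotatePerm ht.le (show l.1.val ≤ m + t.val by omega)
      (show l.2.val ≤ n - (m + t.val) by omega))
    (fun l => comap_blockRotatePerm _ _ _) (by
      rintro ⟨_, l, k⟩ ⟨_, l', k'⟩ h
      obtain ⟨s, b, b'⟩ := j
      cases s <;> cases b <;> cases b' <;> first | exact absurd hj (by decide) | skip
      all_goals
        simp [switchedPair, blockRotatePerm, blockRotate] at h
        ext <;> dsimp only <;> split_ifs at h <;> omega)
  simpa using this

theorem connectivity_weight_bound {n m : ℕ} (hm : 4 * m ≤ n) (hm₀ : 0 < m)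
    (w : SimpleGraph (Fin n) → Fin n × Fin n → ℝ) (hw₀ : ∀ H e, 0 ≤ w H e)
    (hw : ∀ H, ∑ e, w H e ≤ 1) (j : Bool × Bool × Bool) :
    (∑ k : Equiv.Perm (Fin n) × Fin m, w ((twoCycles n n).comap k.1)
        (Prod.map k.1.symm k.1.symm (switchedPair (show m + k.2.val < n by omega) j))) *
      (∑ k : Equiv.Perm (Fin n) × Fin m, w ((twoCycles n (m + k.2)).comap k.1)
        (Prod.map k.1.symm k.1.symm (switchedPair (show m + k.2.val < n by omega) j))) ≤
      (n.factorial / √m) ^ 2 := by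
  have hm' : (0 : ℝ) < m := Nat.cast_pos.2 hm₀
  -- Bounds known for each `t` separately lose a factor `m` when summed over `t`.
  have hsum : ∀ (f : Equiv.Perm (Fin n) → Fin m → ℝ) (c : ℝ),
      (∀ t, m * c * ∑ σ, f σ t ≤ n.factorial) → c * ∑ σ, ∑ t, f σ t ≤ n.factorial := by
    intro f c h
    rw [Finset.sum_comm, Finset.mul_sum]
    refine (Finset.sum_le_card_nsmul _ _ ((n.factorial : ℝ) / m) fun t _ => ?_).trans ?_
    · rw [le_div_iff₀ hm']
      linarith [h t]
    · rw [Finset.card_univ, Fintype.card_fin, nsmul_eq_mul, mul_div_cancel₀ _ hm'.ne']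
  rw [div_pow, Real.sq_sqrt hm'.le, le_div_iff₀ hm', Fintype.sum_prod_type,
    Fintype.sum_prod_type]
  have hnonneg : ∀ r : Fin m → ℕ, 0 ≤ ∑ σ : Equiv.Perm (Fin n), ∑ t : Fin m,
      w ((twoCycles n (r t)).comap σ)
        (Prod.map σ.symm σ.symm (switchedPair (show m + t.val < n by omega) j)) :=
    fun r => Finset.sum_nonneg fun _ _ => Finset.sum_nonneg fun _ _ => hw₀ _ _
  by_cases hj : j.2.1 = j.2.2
  · have h₁ := hsum _ 1 fun t => by
      simpa using sum_cycle_switchedPair_le hm w hw₀ hw t (by omega) j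
    have h₂ := hsum _ m fun t =>
      sum_twoCycles_switchedPair_nonedge_le hm w hw₀ hw t (by omega) j hj
    have := mul_le_mul h₁ h₂ (mul_nonneg hm'.le (hnonneg fun t => m + t)) (by positivity)
    linarith
  · have h₁ := sum_cycle_switchedPair_nonedge_le hm w hw₀ hw j hj
    have h₂ := hsum _ 1 fun t => by
      simpa using sum_twoCycles_switchedPair_le hm w hw₀ hw t (by omega) j
    have := mul_le_mul h₁ h₂ (mul_nonneg zero_le_one (hnonneg fun t => m + t)) (by positivity)
    linarith

/-! ### The lower bound -/

theorem connectivity_adversary_bound {n m : ℕ} (hm : 4 * m ≤ n) (hm₀ : 0 < m) {ε : ℝ}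
    (hε : ε ≤ 1 / 2) (A : QuantumQueryAlgorithm (Fin n × Fin n))
    (hA : DecidesConnectivity n ε A) :
    (√(1 - ε) - √ε) ^ 2 * (m * √m) ≤ 32 * A.queries := by
  have h := A.adversary_bound (K := Equiv.Perm (Fin n) × Fin m) (J := Bool × Bool × Bool)
    (fun k => adjacencyInput ((twoCycles n n).comap k.1))
    (fun k => adjacencyInput ((twoCycles n (m + k.2)).comap k.1))
    (fun j k => Prod.map k.1.symm k.1.symm (switchedPair (show m + k.2.val < n by omega) j))
    (by
      rintro ⟨σ, t⟩ ⟨u, v⟩ h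
      obtain ⟨j, hj⟩ := exists_switchedPair_eq (show m + t.val < n by omega) (σ u) (σ v)
        fun h' => h (by simp [adjacencyInput, h'])
      exact ⟨j, by simp [hj]⟩)
    (p := 1 - ε) (q := ε) (C := n.factorial / √m) (by linarith)
    (fun k => (hA _).1 ((connected_comap_equiv _ _).2 (connected_twoCycles_self (by omega))))
    (fun k => (hA _).2 (mt (connected_comap_equiv _ _).1
      (not_connected_twoCycles (by omega) (by omega))))
    (fun w hw₀ hw j => connectivity_weight_bound hm hm₀ (fun H e => w (adjacencyInput H) e)
      (fun _ _ => hw₀ _ _) (fun _ => hw _) j)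
    (by positivity)
  have hs : 0 < √(m : ℝ) := Real.sqrt_pos.2 (Nat.cast_pos.2 hm₀)
  have hf : (0 : ℝ) < n.factorial := Nat.cast_pos.2 n.factorial_pos
  simp only [Fintype.card_prod, Fintype.card_perm, Fintype.card_fin, Fintype.card_bool] at h
  push_cast at h
  have e : (A.queries : ℝ) * (4 * (8 * (n.factorial / √m))) =
      n.factorial * (32 * A.queries) / √m := by ring
  rw [e, le_div_iff₀ hs] at h
  refine le_of_mul_le_mul_left ?_ hf
  linarith

theorem mainTheorem4 (ε : ℝ) (hε₀ : 0 ≤ ε) (hε : ε < 1 / 2) :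
    ∃ c : ℝ, 0 < c ∧ ∃ N : ℕ, ∀ n : ℕ, N ≤ n →
      ∀ A : QuantumQueryAlgorithm (Fin n × Fin n), DecidesConnectivity n ε A →
        c * (n : ℝ) ^ (3 / 2 : ℝ) ≤ (A.queries : ℝ) := by
  have hγ : 0 < √(1 - ε) - √ε := sub_pos.2 (Real.sqrt_lt_sqrt hε₀ (by linarith))
  -- 32 is the 4 of the one-query estimate times 8 ordered switched pairs; `n / 4` rounded down is
  -- at least `n / 8` once `n ≥ 4`.
  refine ⟨(√(1 - ε) - √ε) ^ 2 / 32 * (1 / 8) ^ (3 / 2 : ℝ), by positivity, 4,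
    fun n hn A hA => ?_⟩
  have h := connectivity_adversary_bound (m := n / 4) (by omega) (by omega) hε.le A hA
  have hm : (n : ℝ) / 8 ≤ (n / 4 : ℕ) := by
    rw [div_le_iff₀ (by norm_num)]
    exact_mod_cast (by omega : n ≤ n / 4 * 8)
  have h₁ : (1 / 8 : ℝ) ^ (3 / 2 : ℝ) * (n : ℝ) ^ (3 / 2 : ℝ) ≤
      (n / 4 : ℕ) * √((n / 4 : ℕ) : ℝ) := by
    rw [← Real.mul_rpow (by norm_num) (Nat.cast_nonneg _)]
    calc _ ≤ ((n / 4 : ℕ) : ℝ) ^ (3 / 2 : ℝ) :=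
          Real.rpow_le_rpow (by positivity) (by linarith) (by norm_num)
      _ = _ := by
          rw [show (3 / 2 : ℝ) = 1 + 1 / 2 by norm_num,
            Real.rpow_add (Nat.cast_pos.2 (by omega)), Real.rpow_one, Real.sqrt_eq_rpow]
  have h₂ := mul_le_mul_of_nonneg_left h₁ (sq_nonneg (√(1 - ε) - √ε))
  linarith
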